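/- Let $k\ge 1$. The odd graph $O_{2k+1}$ has as vertices all $k$-element subsets of $\{1,\dots,2k+1\}$, two of them being adjacent when they are disjoint. A $\mathcal C_\ell$-factor of a finite graph $G$ is a collection of $|V(G)|/\ell$ many vertex-disjoint cycles in $G$, each of length $\ell$. A lattice path with $2k$ steps starts at $(0,0)$ and consists of up-steps $(1,1)$ and down-steps $(1,-1)$. Let $D_{2k}^0$ be the set of Dyck paths with $2k$ steps and no flaws, that is, lattice paths with $k$ up-steps and $k$ down-steps none of whose down-steps lies below the line $y=0$. For a lattice path $x$ let $d_c(x)$ and $u_c(x)$ denote the number of down-steps and of up-steps, respectively, of $x$ that start on the line $y=c$; a step touches the line $y=c$ if it starts or ends on this line. Let $g(x)$ be obtained from $x$ by flipping the $(d_0(x)+1)$-th down-step of $x$ touching the line $y=0$, let $h(x)$ be obtained from $x$ by flipping the $u_1(x)$-th up-step of $x$ touching the line $y=1$, and let $f(x):=h(g(x))$. For $x\in D_{2k}^0$ put $x^i:=f^i(x)$ for $0\le i\le k$ and $y^i:=g(x^i)$ for $0\le i<k$. Identify a lattice path with the set of positions of its up-steps, a subset of $\{1,\dots,2k\}$, and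 put $\overline{y^i}:=(\{1,\dots,2k\}\setminus y^i)\cup\{2k+1\}$. Theorem. For every $k\ge 1$ the odd graph $O_{2k+1}$ has a $\mathcal C_{2k+1}$-factor. More precisely, for every $x\in D_{2k}^0$ the cyclic sequence $$c(x)=(x^0,\overline{y^0},x^1,\overline{y^1},\dots,x^{k-1},\overline{y^{k-1}},x^k)$$ is a cycle of length $2k+1$ in $O_{2k+1}$, distinct $x\in D_{2k}^0$ give distinct cycles, and the cycles $c(x)$, $x\in D_{2k}^0$, form a $\mathcal C_{2k+1}$-factor of $O_{2k+1}$, which consists of exactly $C_k=\frac1{k+1}\binom{2k}{k}$ cycles. -/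

import Mathlib

/-! Lattice paths with `n` steps. The `i`-th entry (`i = 0, …, n - 1`) is the step in position
`i + 1`; it is `DyckStep.U`, a step by `(1, 1)`, or `DyckStep.D`, a step by `(1, -1)`. -/

namespace OddCycles

/-- A lattice path with `n` steps, starting at the origin. -/
abbrev LatticePath (n : ℕ) : Type := Fin n → DyckStep

/-- The change of height caused by a step. -/
def stepValue : DyckStep → ℤ
  | DyckStep.U => 1
  | DyckStep.D => -1

/-- An up-step becomes a down-step and vice versa. -/
def flipStep : DyckStep → DyckStep
  | DyckStep.U => DyckStep.D
  | DyckStep.D => DyckStep.U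

variable {n : ℕ}

/-- The height at which the step with index `i` starts. -/
def startHeight (x : LatticePath n) (i : Fin n) : ℤ :=
  ∑ j : Fin n with j < i, stepValue (x j)

/-- The height at which the step with index `i` ends. -/
def endHeight (x : LatticePath n) (i : Fin n) : ℤ :=
  startHeight x i + stepValue (x i)

/-- The number of flaws: down-steps below the line `y = 0`. -/
def flaws (x : LatticePath n) : ℕ :=
  Finset.card {i : Fin n | x i = DyckStep.D ∧ endHeight x i < 0}

/-- The set of Dyck paths with `2 * k` steps and `e` flaws. -/
def dyckPaths (k e : ℕ) : Set (LatticePath (2 * k)) :=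
  {x | Finset.card {i : Fin (2 * k) | x i = DyckStep.U} = k ∧
    Finset.card {i : Fin (2 * k) | x i = DyckStep.D} = k ∧ flaws x = e}

/-- The number of steps of `x` of type `s` that start on the line `y = c`. -/
def stepsFrom (s : DyckStep) (c : ℤ) (x : LatticePath n) : ℕ :=
  Finset.card {i : Fin n | x i = s ∧ startHeight x i = c}

/-- The step with index `i` of `x` has type `s` and touches (starts or ends on) the line
`y = c`. -/
def Touches (s : DyckStep) (c : ℤ) (x : LatticePath n) (i : Fin n) : Prop :=
  x i = s ∧ (startHeight x i = c ∨ endHeight x i = c)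

instance (s : DyckStep) (c : ℤ) (x : LatticePath n) : DecidablePred (Touches s c x) :=
  fun i => inferInstanceAs (Decidable (x i = s ∧ (startHeight x i = c ∨ endHeight x i = c)))

/-- Flip the `m`-th step (counted from `1`, from left to right) of type `s` of `x` that touches
the line `y = c`. If there is no such step, the path is left unchanged. -/
def flipTouching (s : DyckStep) (c : ℤ) (m : ℕ) (x : LatticePath n) : LatticePath n :=
  fun i =>
    if Touches s c x i ∧ Finset.card {j : Fin n | j ≤ i ∧ Touches s c x j} = m then
      flipStep (x i)
    else x i

/-- Flip the `(d₀(x) + 1)`-th down-step touching `y = 0`, where `d₀(x)` is the number of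
down-steps starting on `y = 0`. -/
def g (x : LatticePath n) : LatticePath n :=
  flipTouching DyckStep.D 0 (stepsFrom DyckStep.D 0 x + 1) x

/-- Flip the `u₁(x)`-th up-step touching `y = 1`, where `u₁(x)` is the number of up-steps
starting on `y = 1`. -/
def h (x : LatticePath n) : LatticePath n :=
  flipTouching DyckStep.U 1 (stepsFrom DyckStep.U 1 x) x

/-- The minimum-change map. -/
def f (x : LatticePath n) : LatticePath n := h (g x)

/-- The positions of the steps of type `s`, as a subset of `{1, …, n}` inside
`{1, …, n + 1}`; here `i : Fin (n + 1)` stands for the number `i + 1`. -/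
def positions (s : DyckStep) (x : LatticePath n) : Finset (Fin (n + 1)) :=
  ({i : Fin n | x i = s} : Finset (Fin n)).map Fin.castSuccEmb

/-- The sequence `x⁰, ȳ⁰, x¹, ȳ¹, …, xᵏ⁻¹, ȳᵏ⁻¹, xᵏ` with `xⁱ = fⁱ(x)` and `yⁱ = g(xⁱ)`,
where paths are viewed as the sets of positions of their up-steps, and `ȳ` consists of the
complement of `y` in `{1, …, 2k}` and the element `2k + 1`. -/
def cycleSeq (k : ℕ) (x : LatticePath (2 * k)) (j : Fin (2 * k + 1)) :
    Finset (Fin (2 * k + 1)) :=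
  if j.val % 2 = 0 then positions DyckStep.U (f^[j.val / 2] x)
  else insert (Fin.last (2 * k)) (positions DyckStep.D (g (f^[j.val / 2] x)))

/-- The odd graph: its vertices are the `k`-element subsets of a set with `2 * k + 1` elements,
and two vertices are adjacent when they are disjoint. (The condition `s ≠ t` matters only for
`k = 0`, where it excludes a loop.) -/
def oddGraph (k : ℕ) : SimpleGraph {s : Finset (Fin (2 * k + 1)) // s.card = k} where
  Adj s t := s ≠ t ∧ Disjoint s.val t.val
  symm := ⟨fun _ _ hst => ⟨hst.1.symm, hst.2.symm⟩⟩
  loopless := ⟨fun _ hs => hs.1 rfl⟩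

/-- `F` is a factor of the finite graph `G` consisting of cycles of length `l`: a collection of
`|V(G)| / l` many vertex-disjoint subgraphs of `G`, each a cycle of length `l`. -/
def IsCycleFactor {V : Type*} [Fintype V] (G : SimpleGraph V) (l : ℕ) (F : Set G.Subgraph) :
    Prop :=
  3 ≤ l ∧
  (∀ H ∈ F, Nonempty (SimpleGraph.cycleGraph l ≃g H.coe)) ∧
  F.PairwiseDisjoint SimpleGraph.Subgraph.verts ∧
  F.ncard * l = Fintype.card V

end OddCycles

namespace OddCycles

open DyckStep

/-! Each path gets a rank (`HasRank`): twice the number of flaws if it ends at height `0`, with an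
odd analogue relative to the line `y = 1` if it ends at height `2`. Each application of `g` or `h`
along the orbit of a flawless path raises the rank by one, and the flipped step can be located again
in the new path (`gStep_spec`, `hStep_spec`); both follow from counting crossings of unit strips to
the left and right of that step. So the rank gives the position in the orbit, and undoing the flips
gives the starting path: all vertices of all sequences are distinct (`cycleSeq_injective`).

Consecutive vertices are disjoint because `g` only turns a down-step into an up-step and `h` does
the reverse. The sequence closes up because its last path is the complement of the first. This is
proved by recursion on the decomposition `U L D R` of a Dyck word, for a word placed inside a larger
path at height `0` or `1` (`IsDyck.reflTransGen_flipStep`); the rank then shows that exactly `2 * k`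
flips were used.

Finally there are `catalan k` cycles, and `catalan k * (2 * k + 1)` is the number of vertices. -/

/-- The height at which a list of steps ends, when started at height `0`. -/
def listHeight : List DyckStep → ℤ
  | [] => 0
  | s :: l => stepValue s + listHeight l

/-- The number of steps of a list satisfying `p`, which may refer to the starting height of the
step, when the list is started at height `b`. -/
def countSteps (p : DyckStep → ℤ → Prop) [∀ s c, Decidable (p s c)] : ℤ → List DyckStep → ℕ
  | _, [] => 0
  | b, s :: l => (if p s b then 1 else 0) + countSteps p (b + stepValue s) l

@[simp] theorem listHeight_nil : listHeight [] = 0 := rfl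
@[simp] theorem listHeight_cons (s : DyckStep) (l : List DyckStep) :
    listHeight (s :: l) = stepValue s + listHeight l := rfl

@[simp] theorem listHeight_append (l m : List DyckStep) :
    listHeight (l ++ m) = listHeight l + listHeight m := by
  induction l with
  | nil => simp
  | cons s l ih => simp [ih, add_assoc]

section
variable (p : DyckStep → ℤ → Prop) [∀ s c, Decidable (p s c)]

@[simp] theorem countSteps_nil (b : ℤ) : countSteps p b [] = 0 := rfl
@[simp] theorem countSteps_cons (b : ℤ) (s : DyckStep) (l : List DyckStep) :
    countSteps p b (s :: l) = (if p s b then 1 else 0) + countSteps p (b + stepValue s) l := rfl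

@[simp] theorem countSteps_append (b : ℤ) (l m : List DyckStep) :
    countSteps p b (l ++ m) = countSteps p b l + countSteps p (b + listHeight l) m := by
  induction l generalizing b with
  | nil => simp
  | cons s l ih => simp [ih, add_assoc]

/-- The count grows by at most one per step, so some step takes it from `m` to `m + 1`; `P` is what
precedes that step. -/
theorem exists_split_of_lt_countSteps (b : ℤ) (l : List DyckStep) (m : ℕ)
    (hm : m < countSteps p b l) :
    ∃ P s Q, l = P ++ s :: Q ∧ countSteps p b P = m ∧ p s (b + listHeight P) := by
  induction l generalizing b m with
  | nil => simp at hm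
  | cons s l ih =>
    rw [countSteps_cons] at hm
    by_cases hs : p s b
    · rcases m with _ | m
      · exact ⟨[], s, l, by simp, rfl, by simpa using hs⟩
      · obtain ⟨P, t, Q, h1, h2, h3⟩ := ih (b + stepValue s) m (by rw [if_pos hs] at hm; omega)
        refine ⟨s :: P, t, Q, by simp [h1], by simp [hs, h2, add_comm], ?_⟩
        simpa [add_assoc] using h3
    · obtain ⟨P, t, Q, h1, h2, h3⟩ := ih (b + stepValue s) m (by rw [if_neg hs] at hm; omega)
      refine ⟨s :: P, t, Q, by simp [h1], by simp [hs, h2], ?_⟩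
      simpa [add_assoc] using h3

end

/-! ### Counting steps by height -/

/-- The number of steps of type `s` starting at height `c`. -/
def countFrom (s : DyckStep) (c b : ℤ) (l : List DyckStep) : ℕ :=
  countSteps (fun t a => t = s ∧ a = c) b l

/-- The number of steps of type `s` starting or ending at height `c`. -/
def countTouching (s : DyckStep) (c b : ℤ) (l : List DyckStep) : ℕ :=
  countSteps (fun t a => t = s ∧ (a = c ∨ a + stepValue t = c)) b l

/-- The number of down-steps starting at height at most `c`. -/
def countDownLE (c b : ℤ) (l : List DyckStep) : ℕ :=
  countSteps (fun t a => t = D ∧ a ≤ c) b l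

@[simp] theorem countFrom_nil (s : DyckStep) (c b : ℤ) : countFrom s c b [] = 0 := rfl
@[simp] theorem countFrom_cons (s : DyckStep) (c b : ℤ) (t : DyckStep) (l : List DyckStep) :
    countFrom s c b (t :: l) =
      (if t = s ∧ b = c then 1 else 0) + countFrom s c (b + stepValue t) l := rfl
@[simp] theorem countFrom_append (s : DyckStep) (c b : ℤ) (l m : List DyckStep) :
    countFrom s c b (l ++ m) = countFrom s c b l + countFrom s c (b + listHeight l) m :=
  countSteps_append _ b l m

@[simp] theorem countTouching_nil (s : DyckStep) (c b : ℤ) : countTouching s c b [] = 0 := rfl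
@[simp] theorem countTouching_cons (s : DyckStep) (c b : ℤ) (t : DyckStep) (l : List DyckStep) :
    countTouching s c b (t :: l) =
      (if t = s ∧ (b = c ∨ b + stepValue t = c) then 1 else 0) +
        countTouching s c (b + stepValue t) l := rfl
@[simp] theorem countTouching_append (s : DyckStep) (c b : ℤ) (l m : List DyckStep) :
    countTouching s c b (l ++ m) =
      countTouching s c b l + countTouching s c (b + listHeight l) m :=
  countSteps_append _ b l m

@[simp] theorem countDownLE_nil (c b : ℤ) : countDownLE c b [] = 0 := rfl
@[simp] theorem countDownLE_cons (c b : ℤ) (t : DyckStep) (l : List DyckStep) :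
    countDownLE c b (t :: l) =
      (if t = D ∧ b ≤ c then 1 else 0) + countDownLE c (b + stepValue t) l := rfl
@[simp] theorem countDownLE_append (c b : ℤ) (l m : List DyckStep) :
    countDownLE c b (l ++ m) = countDownLE c b l + countDownLE c (b + listHeight l) m :=
  countSteps_append _ b l m

theorem countTouching_D (c b : ℤ) (l : List DyckStep) :
    countTouching D c b l = countFrom D c b l + countFrom D (c + 1) b l := by
  induction l generalizing b with
  | nil => rfl
  | cons s l ih =>
    have := ih (b + stepValue s)
    rcases s with _ | _ <;>
      simp only [countTouching_cons, countFrom_cons, stepValue, true_and, false_and,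
        reduceCtorEq, if_false] at this ⊢ <;> grind

theorem countTouching_U (c b : ℤ) (l : List DyckStep) :
    countTouching U c b l = countFrom U c b l + countFrom U (c - 1) b l := by
  induction l generalizing b with
  | nil => rfl
  | cons s l ih =>
    have := ih (b + stepValue s)
    rcases s with _ | _ <;>
      simp only [countTouching_cons, countFrom_cons, stepValue, true_and, false_and,
        reduceCtorEq, if_false] at this ⊢ <;> grind

theorem countDownLE_add_one (c b : ℤ) (l : List DyckStep) :
    countDownLE (c + 1) b l = countDownLE c b l + countFrom D (c + 1) b l := by
  induction l generalizing b with
  | nil => rfl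
  | cons s l ih =>
    have := ih (b + stepValue s)
    rcases s with _ | _ <;>
      simp only [countDownLE_cons, countFrom_cons, stepValue, true_and, false_and,
        reduceCtorEq, if_false] at this ⊢ <;> grind

/-- Every crossing of the strip between two consecutive lines is upward or downward. -/
theorem countFrom_U_add (c b : ℤ) (l : List DyckStep) :
    countFrom U c b l + (if c < b then 1 else 0) =
      countFrom D (c + 1) b l + (if c < b + listHeight l then 1 else 0) := by
  induction l generalizing b with
  | nil => simp
  | cons s l ih =>
    have := ih (b + stepValue s)
    rcases s with _ | _ <;>
      simp only [countFrom_cons, listHeight_cons, ← add_assoc, stepValue, true_and, false_and,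
        reduceCtorEq, if_false] at this ⊢ <;> grind

theorem countFrom_shift (s : DyckStep) (d c b : ℤ) (l : List DyckStep) :
    countFrom s (c + d) (b + d) l = countFrom s c b l := by
  induction l generalizing b with
  | nil => rfl
  | cons t l ih =>
    have := ih (b + stepValue t)
    rw [add_right_comm] at this
    simp only [countFrom_cons, this, add_left_inj]

theorem countDownLE_shift (d c b : ℤ) (l : List DyckStep) :
    countDownLE (c + d) (b + d) l = countDownLE c b l := by
  induction l generalizing b with
  | nil => rfl
  | cons t l ih =>
    have := ih (b + stepValue t)
    rw [add_right_comm] at this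
    simp only [countDownLE_cons, this, add_le_add_iff_right]

/-! ### Lattice paths as lists -/

variable {n : ℕ}

theorem startHeight_zero (x : LatticePath (n + 1)) : startHeight x 0 = 0 := by
  simp [startHeight]

theorem startHeight_succ (x : LatticePath (n + 1)) (i : Fin n) :
    startHeight x i.succ = stepValue (x 0) + startHeight (fun j => x j.succ) i := by
  simp [startHeight, Finset.sum_filter, Fin.sum_univ_succ]

section
variable (p : DyckStep → ℤ → Prop) [∀ s c, Decidable (p s c)]

/-- The base height `b` lets the induction peel off the first step; the cutoff `m` gives the ordinal
of a step among those touching a line. -/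
theorem card_filter_le_eq_countSteps (x : LatticePath n) (b : ℤ) (m : ℕ) :
    Finset.card {i : Fin n | i.val < m ∧ p (x i) (b + startHeight x i)} =
      countSteps p b ((List.ofFn x).take m) := by
  induction n generalizing b m with
  | zero => simp
  | succ n ih =>
    rcases m with _ | m
    · simp
    · have := ih (fun j => x j.succ) (b + stepValue (x 0)) m
      rw [Fin.card_filter_univ_succ]
      simp only [List.ofFn_succ, List.take_succ_cons, countSteps_cons, ← this, startHeight_zero,
        startHeight_succ, add_zero, add_assoc, Fin.val_succ, Fin.val_zero,
        Nat.zero_lt_succ, true_and, add_lt_add_iff_right]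
      split_ifs <;> simp [add_comm]

theorem card_filter_eq_countSteps (x : LatticePath n) :
    Finset.card {i : Fin n | p (x i) (startHeight x i)} = countSteps p 0 (List.ofFn x) := by
  have := card_filter_le_eq_countSteps p x 0 n
  rw [List.take_of_length_le (by simp)] at this
  simpa using this

end

theorem startHeight_eq_listHeight (x : LatticePath n) (i : Fin n) :
    startHeight x i = listHeight ((List.ofFn x).take i) := by
  induction n with
  | zero => exact i.elim0
  | succ n ih =>
    refine Fin.cases ?_ (fun i => ?_) i
    · simp [startHeight_zero]
    · simp [startHeight_succ, ih]

theorem stepsFrom_eq_countFrom (s : DyckStep) (c : ℤ) (x : LatticePath n) :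
    stepsFrom s c x = countFrom s c 0 (List.ofFn x) :=
  card_filter_eq_countSteps (fun t a => t = s ∧ a = c) x

theorem flaws_eq_countDownLE (x : LatticePath n) :
    flaws x = countDownLE 0 0 (List.ofFn x) := by
  rw [countDownLE, ← card_filter_eq_countSteps, flaws]
  congr 1
  ext i
  rw [Finset.mem_filter_univ, Finset.mem_filter_univ, endHeight]
  constructor <;> rintro ⟨h1, h2⟩ <;> simp only [h1, stepValue, true_and] at h2 ⊢ <;> omega

theorem ofFn_flipTouching (s : DyckStep) (c : ℤ) (m : ℕ) (x : LatticePath n)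
    (P Q : List DyckStep) (hx : List.ofFn x = P ++ s :: Q)
    (ht : listHeight P = c ∨ listHeight P + stepValue s = c)
    (hm : countTouching s c 0 P + 1 = m) :
    List.ofFn (flipTouching s c m x) = P ++ flipStep s :: Q := by
  have hlen : n = P.length + (Q.length + 1) := by
    have := congrArg List.length hx
    simpa using this
  have hPn : P.length < n := by omega
  set i : Fin n := ⟨P.length, hPn⟩ with hi
  have hget : ∀ j : Fin n, x j = (P ++ s :: Q)[j.val]'(by simp; omega) := by
    intro j
    have : x j = (List.ofFn x)[j.val]'(by simp) := by simp
    rw [this]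
    simp [hx]
  have hxi : x i = s := by rw [hget]; simp [hi]
  have hstart : startHeight x i = listHeight P := by
    rw [startHeight_eq_listHeight, hx]; simp [hi]
  have htouch : Touches s c x i := by
    refine ⟨hxi, ?_⟩
    rw [endHeight, hstart, hxi]; exact ht
  have hcount (j : Fin n) : Finset.card {l : Fin n | l ≤ j ∧ Touches s c x l} =
      countTouching s c 0 ((List.ofFn x).take (j + 1)) := by
    rw [countTouching, ← card_filter_le_eq_countSteps]
    congr 1
    ext l
    rw [Finset.mem_filter_univ, Finset.mem_filter_univ, Touches, endHeight, Fin.le_def,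
      Nat.lt_succ_iff, zero_add]
  have hci : Finset.card {l : Fin n | l ≤ i ∧ Touches s c x l} = m := by
    rw [hcount, hx, ← hm]
    simp [hi, List.take_append, List.take_of_length_le, ht]
  have huniq (j : Fin n) (hj : Touches s c x j)
      (hc : Finset.card {l : Fin n | l ≤ j ∧ Touches s c x l} = m) : j = i := by
    by_contra hne
    -- The ordinal strictly increases along touching steps, so only one step has ordinal `m`.
    have key : ∀ a b : Fin n, a < b → Touches s c x b →
        Finset.card {l : Fin n | l ≤ a ∧ Touches s c x l} <
        Finset.card {l : Fin n | l ≤ b ∧ Touches s c x l} := by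
      intro a b hab hb
      apply Finset.card_lt_card
      rw [Finset.ssubset_iff_of_subset]
      · exact ⟨b, by simp [hb], by simp [hab]⟩
      · intro l
        simp only [Finset.mem_filter, Finset.mem_univ, true_and]
        exact fun ⟨h1, h2⟩ => ⟨h1.trans hab.le, h2⟩
    rcases lt_or_gt_of_ne hne with hlt | hlt
    · have := key _ _ hlt htouch; omega
    · have := key _ _ hlt hj; omega
  apply List.ext_getElem
  · simp [hlen, add_assoc]
  · intro j h1 h2
    simp only [List.length_ofFn] at h1
    rw [List.getElem_ofFn]
    by_cases hj : j = P.length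
    · subst hj
      rw [flipTouching, if_pos ⟨htouch, hci⟩, hxi]
      simp
    · rw [flipTouching, if_neg, hget]
      · rcases lt_or_gt_of_ne hj with hlt | hlt
        · simp [hlt]
        · simp [List.getElem_append, List.getElem_cons, hlt.not_gt, show j - P.length ≠ 0 by omega]
      · rintro ⟨ha, hb⟩
        exact hj (congrArg Fin.val (huniq _ ha hb))


/-! ### The two flips on lists -/

/-- `l'` arises from `l`, a list ending at height `0`, by flipping the `(d₀ + 1)`-th down-step
touching the line `y = 0`. -/
def GStep (l l' : List DyckStep) : Prop :=
  ∃ P Q, l = P ++ D :: Q ∧ l' = P ++ U :: Q ∧ listHeight l = 0 ∧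
    (listHeight P = 0 ∨ listHeight P = 1) ∧ countTouching D 0 0 P = countFrom D 0 0 l

/-- `l'` arises from `l`, a list ending at height `2`, by flipping the `u₁`-th up-step
touching the line `y = 1`. -/
def HStep (l l' : List DyckStep) : Prop :=
  ∃ P Q, l = P ++ U :: Q ∧ l' = P ++ D :: Q ∧ listHeight l = 2 ∧
    (listHeight P = 0 ∨ listHeight P = 1) ∧ countTouching U 1 0 P + 1 = countFrom U 1 0 l

/-- The hypothesis `hc` compares the down-steps of `P` from height `1` with those of `Q` from height
`0`. Up and down crossings of a strip balance up to the end heights, which turns this into a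
comparison of up-steps. The flip lifts `Q` by `2`, hence the shifts. The last conclusion says that
`gInv` finds the same step. -/
theorem gStep_spec {P Q : List DyckStep} (h0 : listHeight (P ++ D :: Q) = 0)
    (hP : listHeight P = 0 ∨ listHeight P = 1)
    (hc : countTouching D 0 0 P = countFrom D 0 0 (P ++ D :: Q)) :
    listHeight (P ++ U :: Q) = 2 ∧
    countDownLE 1 0 (P ++ U :: Q) = countDownLE 0 0 (P ++ D :: Q) ∧
    countTouching U 1 0 P = countFrom U 1 0 (P ++ U :: Q) := by
  have e1 := countFrom_U_add 0 0 P
  have e2 := countDownLE_add_one 0 0 P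
  rw [countTouching_D] at hc
  rw [countTouching_U]
  simp only [listHeight_append, listHeight_cons, stepValue, countFrom_append, countFrom_cons,
    countDownLE_append, countDownLE_cons, true_and, false_and, reduceCtorEq, if_false] at *
  rcases hP with hP | hP
  · have hQ : listHeight Q = 1 := by omega
    have e3 := countFrom_U_add (-1) (-1) Q
    have e4 := countDownLE_add_one (-1) (-1) Q
    have e5 := countFrom_shift U 2 (-1) (-1) Q
    have e6 := countDownLE_shift 2 (-1) (-1) Q
    simp only [hP, hQ] at *
    norm_num at *
    omega
  · have hQ : listHeight Q = 0 := by omega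
    have e3 := countFrom_U_add (-1) 0 Q
    have e4 := countDownLE_add_one (-1) 0 Q
    have e5 := countFrom_shift U 2 (-1) 0 Q
    have e6 := countDownLE_shift 2 (-1) 0 Q
    simp only [hP, hQ] at *
    norm_num at *
    omega

/-- The same accounting with `Q` lowered by `2`. The comparison of `P` with `Q` is now off by one,
and this is the extra flaw. -/
theorem hStep_spec {P Q : List DyckStep} (h0 : listHeight (P ++ U :: Q) = 2)
    (hP : listHeight P = 0 ∨ listHeight P = 1)
    (hc : countTouching U 1 0 P + 1 = countFrom U 1 0 (P ++ U :: Q)) :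
    listHeight (P ++ D :: Q) = 0 ∧
    countDownLE 0 0 (P ++ D :: Q) = countDownLE 1 0 (P ++ U :: Q) + 1 ∧
    countTouching D 0 0 P + 1 = countFrom D 0 0 (P ++ D :: Q) := by
  have e1 := countFrom_U_add 0 0 P
  have e2 := countDownLE_add_one 0 0 P
  rw [countTouching_U] at hc
  rw [countTouching_D]
  simp only [listHeight_append, listHeight_cons, stepValue, countFrom_append, countFrom_cons,
    countDownLE_append, countDownLE_cons, true_and, false_and, reduceCtorEq, if_false] at *
  rcases hP with hP | hP
  · have hQ : listHeight Q = 1 := by omega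
    have e3 := countFrom_U_add (-1) (-1) Q
    have e4 := countDownLE_add_one (-1) (-1) Q
    have e5 := countFrom_shift U 2 (-1) (-1) Q
    have e6 := countDownLE_shift 2 (-1) (-1) Q
    simp only [hP, hQ] at *
    norm_num at *
    omega
  · have hQ : listHeight Q = 0 := by omega
    have e3 := countFrom_U_add (-1) 0 Q
    have e4 := countDownLE_add_one (-1) 0 Q
    have e5 := countFrom_shift U 2 (-1) 0 Q
    have e6 := countDownLE_shift 2 (-1) 0 Q
    simp only [hP, hQ] at *
    norm_num at *
    omega

theorem exists_gStep {l : List DyckStep} (h0 : listHeight l = 0) (hl : 0 < countFrom D 1 0 l) :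
    ∃ l', GStep l l' := by
  have h1 : countFrom D 0 0 l < countTouching D 0 0 l := by
    rw [countTouching_D, zero_add]; omega
  obtain ⟨P, s, Q, rfl, h2, rfl, h3⟩ := exists_split_of_lt_countSteps _ 0 l _ h1
  refine ⟨_, P, Q, rfl, rfl, h0, ?_, h2⟩
  simp only [stepValue] at h3
  omega

theorem exists_hStep {l : List DyckStep} (h0 : listHeight l = 2) : ∃ l', HStep l l' := by
  -- Ending above `y = 1` forces an up-step from that line, so `u₁ - 1` below is not truncated.
  have h4 := countFrom_U_add 1 0 l
  simp [h0] at h4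
  have h1 : countFrom U 1 0 l - 1 < countTouching U 1 0 l := by
    rw [countTouching_U]; omega
  obtain ⟨P, s, Q, rfl, h2, rfl, h3⟩ := exists_split_of_lt_countSteps _ 0 l _ h1
  refine ⟨_, P, Q, rfl, rfl, h0, ?_, ?_⟩
  · simp only [stepValue] at h3
    omega
  · rw [countTouching, h2]; omega

/-- Without a down-step from height `1` a list that is above `0` could not come back, so it stays at
or below `0` throughout. -/
theorem countDownLE_eq_count {b : ℤ} {l : List DyckStep} (h0 : b + listHeight l ≤ 0)
    (hl : countFrom D 1 b l = 0) : countDownLE 0 b l = l.count D := by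
  induction l generalizing b with
  | nil => rfl
  | cons s l ih =>
    have hb := countFrom_U_add 0 b (s :: l)
    rw [zero_add, hl, if_neg h0.not_gt] at hb
    have hb : ¬ 0 < b := by
      intro h
      rw [if_pos h] at hb
      omega
    rw [listHeight_cons] at h0
    rw [countFrom_cons] at hl
    rw [countDownLE_cons, ih (by omega) (by omega), List.count_cons]
    rcases s with _ | _ <;> (simp [add_comm]; try omega)

/-! ### Reaching the complement of a Dyck path -/

/-- The lists of steps of Dyck paths without flaws. -/
inductive IsDyck : List DyckStep → Prop
  | nil : IsDyck []
  | cons {l r : List DyckStep} : IsDyck l → IsDyck r → IsDyck (U :: (l ++ D :: r))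

namespace IsDyck

variable {w : List DyckStep}

theorem listHeight_eq (hw : IsDyck w) : listHeight w = 0 := by
  induction hw with
  | nil => rfl
  | cons _ _ ih1 ih2 => simp [ih1, ih2, stepValue]

theorem listHeight_map (hw : IsDyck w) : listHeight (w.map flipStep) = 0 := by
  induction hw with
  | nil => rfl
  | cons _ _ ih1 ih2 => simp [ih1, ih2, stepValue, flipStep]

theorem countFrom_U_eq_zero (hw : IsDyck w) {b c : ℤ} (hc : c < b) : countFrom U c b w = 0 := by
  induction hw generalizing b with
  | nil => rfl
  | cons h1 _ ih1 ih2 =>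
    simp [h1.listHeight_eq, stepValue, ih1 (show c < b + 1 by omega), ih2 hc, hc.ne']

theorem countFrom_D_eq_zero (hw : IsDyck w) {b c : ℤ} (hc : c ≤ b) : countFrom D c b w = 0 := by
  induction hw generalizing b with
  | nil => rfl
  | cons h1 _ ih1 ih2 =>
    simp [h1.listHeight_eq, stepValue, ih1 (show c ≤ b + 1 by omega), ih2 hc,
      show b + 1 ≠ c by omega]

theorem countFrom_U_map_eq_zero (hw : IsDyck w) {b c : ℤ} (hc : b ≤ c) :
    countFrom U c b (w.map flipStep) = 0 := by
  induction hw generalizing b with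
  | nil => rfl
  | cons h1 _ ih1 ih2 =>
    simp [h1.listHeight_map, stepValue, flipStep, ih1 (show b + -1 ≤ c by omega), ih2 hc,
      show b + -1 ≠ c by omega]

theorem countFrom_D_map_eq_zero (hw : IsDyck w) {b c : ℤ} (hc : b < c) :
    countFrom D c b (w.map flipStep) = 0 := by
  induction hw generalizing b with
  | nil => rfl
  | cons h1 _ ih1 ih2 =>
    simp [h1.listHeight_map, stepValue, flipStep, ih1 (show b + -1 < c by omega), ih2 hc,
      hc.ne]

end IsDyck

/-- A single flip. -/
def FlipStep (l l' : List DyckStep) : Prop := GStep l l' ∨ HStep l l'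

theorem flipStep_of_G {P Q : List DyckStep} (h0 : listHeight (P ++ D :: Q) = 0)
    (hP : listHeight P = 0 ∨ listHeight P = 1)
    (hc : countFrom D 0 0 P + countFrom D 1 0 P = countFrom D 0 0 (P ++ D :: Q)) :
    FlipStep (P ++ D :: Q) (P ++ U :: Q) :=
  Or.inl ⟨P, Q, rfl, rfl, h0, hP, by rw [countTouching_D, ← hc, zero_add]⟩

theorem flipStep_of_H {P Q : List DyckStep} (h0 : listHeight (P ++ U :: Q) = 2)
    (hP : listHeight P = 0 ∨ listHeight P = 1)
    (hc : countFrom U 1 0 P + countFrom U 0 0 P + 1 = countFrom U 1 0 (P ++ U :: Q)) :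
    FlipStep (P ++ U :: Q) (P ++ D :: Q) :=
  Or.inr ⟨P, Q, rfl, rfl, h0, hP, by rw [countTouching_U, ← hc, sub_self]⟩

-- The conditions on `P` and `Q` make the flip counters point into `w`; heights keep the irrelevant
-- parts of `w` out of the counts. For `w = U L D R` at height `0` the flips come in the order `D`,
-- `L`, `U`, `R`, and `L` is handled at height `1`. At height `1` the order is `R`, `U`, `L`, `D`,
-- and `L` is handled at height `0`. So the two claims must be proved together.
open Relation in
theorem IsDyck.reflTransGen_flipStep {w : List DyckStep} (hw : IsDyck w) :
    (∀ P Q, listHeight P = 0 → listHeight Q = 0 → countFrom D 1 0 P = countFrom D 0 0 Q →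
      ReflTransGen FlipStep (P ++ (w ++ Q)) (P ++ (w.map flipStep ++ Q))) ∧
    (∀ P Q, listHeight P = 1 → listHeight Q = 1 → countFrom U 0 0 P = countFrom U 1 1 Q →
      ReflTransGen FlipStep (P ++ (w ++ Q)) (P ++ (w.map flipStep ++ Q))) := by
  induction hw with
  | nil => exact ⟨fun P Q _ _ _ => .refl, fun P Q _ _ _ => .refl⟩
  | @cons L R hL hR ihL ihR =>
    refine ⟨fun P Q hP hQ hc => ?_, fun P Q hP hQ hc => ?_⟩
    · have e1 := countFrom_U_add 0 0 P
      have e2 := countFrom_U_add (-1) 0 Q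
      have e3 := countFrom_shift U 2 (-1) 0 Q
      norm_num [hP, hQ] at e1 e2 e3
      have s1 : FlipStep ((P ++ U :: L) ++ D :: (R ++ Q)) ((P ++ U :: L) ++ U :: (R ++ Q)) := by
        apply flipStep_of_G
        · simp [hP, hQ, hL.listHeight_eq, hR.listHeight_eq, stepValue]
        · simp [hP, hL.listHeight_eq, stepValue]
        · simp [hP, hL.listHeight_eq, hR.listHeight_eq, stepValue, hL.countFrom_D_eq_zero,
            hR.countFrom_D_eq_zero, hc]
      have s2 := ihL.2 (P ++ [U]) (U :: (R ++ Q)) (by simp [hP, stepValue])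
        (by simp [hQ, hR.listHeight_eq, stepValue])
        (by simp [hP, hR.listHeight_eq, stepValue, hR.countFrom_U_eq_zero]; omega)
      have s3 : FlipStep (P ++ U :: (L.map flipStep ++ U :: (R ++ Q)))
          (P ++ D :: (L.map flipStep ++ U :: (R ++ Q))) := by
        apply flipStep_of_H
        · simp [hP, hQ, hL.listHeight_map, hR.listHeight_eq, stepValue]
        · simp [hP]
        · simp [hP, hL.listHeight_map, hR.listHeight_eq, stepValue, hL.countFrom_U_map_eq_zero,
            hR.countFrom_U_eq_zero]; omega
      have s4 := ihR.1 (P ++ D :: (L.map flipStep ++ [U])) Q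
        (by simp [hP, hL.listHeight_map, stepValue]) hQ
        (by simp [hP, hL.listHeight_map, stepValue, hL.countFrom_D_map_eq_zero, hc])
      simp only [List.append_assoc, List.cons_append, List.nil_append, List.map_append,
        List.map_cons, flipStep] at s1 s2 s3 s4 ⊢
      exact ((ReflTransGen.head s1 s2).tail s3).trans s4
    · have e1 := countFrom_U_add 0 0 P
      have e2 := countFrom_U_add 1 1 Q
      have e3 := countFrom_shift D 2 0 (-1) Q
      norm_num [hP, hQ] at e1 e2 e3
      have s1 := ihR.2 (P ++ U :: (L ++ [D])) Q
        (by simp [hP, hL.listHeight_eq, stepValue]) hQ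
        (by simp [hP, hL.listHeight_eq, stepValue, hL.countFrom_U_eq_zero, hc])
      have s2 : FlipStep (P ++ U :: (L ++ D :: (R.map flipStep ++ Q)))
          (P ++ D :: (L ++ D :: (R.map flipStep ++ Q))) := by
        apply flipStep_of_H
        · simp [hP, hQ, hL.listHeight_eq, hR.listHeight_map, stepValue]
        · simp [hP]
        · simp [hP, hL.listHeight_eq, hR.listHeight_map, stepValue, hL.countFrom_U_eq_zero,
            hR.countFrom_U_map_eq_zero]; omega
      have s3 := ihL.1 (P ++ [D]) (D :: (R.map flipStep ++ Q)) (by simp [hP, stepValue])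
        (by simp [hQ, hR.listHeight_map, stepValue])
        (by simp [hP, hR.listHeight_map, stepValue, hR.countFrom_D_map_eq_zero]; omega)
      have s4 : FlipStep ((P ++ D :: L.map flipStep) ++ D :: (R.map flipStep ++ Q))
          ((P ++ D :: L.map flipStep) ++ U :: (R.map flipStep ++ Q)) := by
        apply flipStep_of_G
        · simp [hP, hQ, hL.listHeight_map, hR.listHeight_map, stepValue]
        · simp [hP, hL.listHeight_map, stepValue]
        · simp [hP, hL.listHeight_map, hR.listHeight_map, stepValue, hL.countFrom_D_map_eq_zero,
            hR.countFrom_D_map_eq_zero]; omega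
      simp only [List.append_assoc, List.cons_append, List.nil_append, List.map_append,
        List.map_cons, flipStep] at s1 s2 s3 s4 ⊢
      exact ((s1.tail s2).trans s3).tail s4

theorem isDyck_toList (p : DyckWord) : IsDyck p.toList := by
  by_cases hp : p = 0
  · rw [hp]; exact .nil
  · have h1 := p.semilength_insidePart_lt hp
    have h2 := p.semilength_outsidePart_lt hp
    have := IsDyck.cons (isDyck_toList p.insidePart) (isDyck_toList p.outsidePart)
    rw [← DyckWord.nest_insidePart_add_outsidePart hp]
    have e : ∀ a b : DyckWord, (a.nest + b).toList = U :: (a.toList ++ D :: b.toList) := by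
      intro a b
      change ([U] ++ a.toList ++ [D]) ++ b.toList = _
      simp
    rw [e]
    exact this
termination_by p.semilength


/-! ### Flawless paths and Dyck words -/

theorem listHeight_eq_count (l : List DyckStep) :
    listHeight l = (l.count U : ℤ) - l.count D := by
  induction l with
  | nil => rfl
  | cons s l ih => rcases s with _ | _ <;> simp [ih, stepValue] <;> ring

theorem count_U_add_count_D (l : List DyckStep) : l.count U + l.count D = l.length := by
  induction l with
  | nil => rfl
  | cons s l ih => rcases s with _ | _ <;> simp <;> omega

theorem countDownLE_eq_zero_iff {b : ℤ} (hb : 0 ≤ b) (l : List DyckStep) :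
    countDownLE 0 b l = 0 ↔ ∀ i, 0 ≤ b + listHeight (l.take i) := by
  induction l generalizing b with
  | nil => simp [hb]
  | cons s l ih =>
    have key : (∀ i, 0 ≤ b + listHeight ((s :: l).take i)) ↔
        ∀ i, 0 ≤ b + stepValue s + listHeight (l.take i) := by
      constructor
      · intro h i
        have := h (i + 1)
        rwa [List.take_succ_cons, listHeight_cons, ← add_assoc] at this
      · rintro h (_ | i)
        · simpa using hb
        · rw [List.take_succ_cons, listHeight_cons, ← add_assoc]
          exact h i
    rw [key, countDownLE_cons]
    rcases s with _ | _
    · rw [← ih (by simp only [stepValue]; omega)]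
      simp
    · by_cases h : 0 < b
      · rw [← ih (by simp only [stepValue]; omega)]
        simp [h]
      · have hb0 : b = 0 := by omega
        subst hb0
        simp only [le_refl, and_self, if_true, Nat.add_eq_zero_iff, one_ne_zero, false_and,
          false_iff, not_forall]
        exact ⟨0, by simp [stepValue]⟩

variable {k : ℕ}

theorem card_filter_eq_count (s : DyckStep) (x : LatticePath n) :
    Finset.card {i : Fin n | x i = s} = (List.ofFn x).count s := by
  rw [card_filter_eq_countSteps (fun t _ => t = s)]
  generalize (0 : ℤ) = b
  generalize List.ofFn x = l
  induction l generalizing b with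
  | nil => rfl
  | cons t l ih => simp [ih, List.count_cons, add_comm]

theorem count_U_add_count_D_ofFn (x : LatticePath n) :
    (List.ofFn x).count U + (List.ofFn x).count D = n := by
  rw [count_U_add_count_D, List.length_ofFn]

theorem mem_dyckPaths_iff {e : ℕ} {x : LatticePath (2 * k)} :
    x ∈ dyckPaths k e ↔
      listHeight (List.ofFn x) = 0 ∧ countDownLE 0 0 (List.ofFn x) = e := by
  have h1 := count_U_add_count_D_ofFn x
  rw [dyckPaths, Set.mem_ofPred_eq, flaws_eq_countDownLE, card_filter_eq_count,
    card_filter_eq_count, listHeight_eq_count]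
  omega

theorem exists_dyckWord {x : LatticePath (2 * k)} (hx : x ∈ dyckPaths k 0) :
    ∃ p : DyckWord, p.toList = List.ofFn x := by
  rw [mem_dyckPaths_iff, countDownLE_eq_zero_iff le_rfl] at hx
  obtain ⟨h1, h2⟩ := hx
  refine ⟨⟨List.ofFn x, ?_, fun i => ?_⟩, rfl⟩
  · rw [listHeight_eq_count] at h1; omega
  · have := h2 i
    rw [listHeight_eq_count] at this; omega

theorem dyckWord_mem_dyckPaths {p : DyckWord} {x : LatticePath (2 * k)}
    (h : p.toList = List.ofFn x) : x ∈ dyckPaths k 0 := by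
  rw [mem_dyckPaths_iff, countDownLE_eq_zero_iff le_rfl, ← h]
  constructor
  · rw [listHeight_eq_count, p.count_U_eq_count_D, sub_self]
  · intro i
    have := p.count_D_le_count_U i
    rw [listHeight_eq_count]; omega

theorem card_dyckPaths_zero (k : ℕ) : Nat.card (dyckPaths k 0) = catalan k := by
  rw [← DyckWord.card_dyckWord_semilength_eq_catalan, ← Nat.card_eq_fintype_card]
  choose F hF using fun x : dyckPaths k 0 => exists_dyckWord x.2
  have hs : ∀ x, (F x).semilength = k := by
    intro x
    have := (F x).two_mul_semilength_eq_length
    rw [hF, List.length_ofFn] at this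
    omega
  refine Nat.card_eq_of_bijective (fun x => (⟨F x, hs x⟩ : {p : DyckWord // p.semilength = k}))
    ⟨fun x y hxy => ?_, fun ⟨p, hp⟩ => ?_⟩
  · have h1 : F x = F y := congrArg Subtype.val hxy
    have h2 := hF x
    rw [h1, hF y] at h2
    exact Subtype.ext (List.ofFn_injective h2.symm)
  · have hlen : p.toList.length = 2 * k := by rw [← p.two_mul_semilength_eq_length, hp]
    have hx : p.toList = List.ofFn fun i : Fin (2 * k) => p.toList[i.val]'(by omega) := by
      apply List.ext_getElem
      · simp [hlen]
      · intro i h1 h2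
        simp
    refine ⟨⟨_, dyckWord_mem_dyckPaths hx⟩, Subtype.ext ?_⟩
    apply DyckWord.ext
    rw [hF, ← hx]

/-! ### The sequence of paths -/

theorem ofFn_g {x : LatticePath n} {l' : List DyckStep} (hx : GStep (List.ofFn x) l') :
    List.ofFn (g x) = l' := by
  obtain ⟨P, Q, h1, rfl, -, h3, h4⟩ := hx
  refine ofFn_flipTouching D 0 _ x P Q h1 ?_ ?_
  · simp only [stepValue]; omega
  · rw [h4, stepsFrom_eq_countFrom]

theorem ofFn_h {x : LatticePath n} {l' : List DyckStep} (hx : HStep (List.ofFn x) l') :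
    List.ofFn (h x) = l' := by
  obtain ⟨P, Q, h1, rfl, -, h3, h4⟩ := hx
  refine ofFn_flipTouching U 1 _ x P Q h1 ?_ ?_
  · simp only [stepValue]; omega
  · rw [h4, stepsFrom_eq_countFrom]

/-- The inverse of `g`. -/
def gInv (y : LatticePath n) : LatticePath n :=
  flipTouching U 1 (stepsFrom U 1 y + 1) y

/-- The inverse of `h`. -/
def hInv (z : LatticePath n) : LatticePath n :=
  flipTouching D 0 (stepsFrom D 0 z) z

theorem gInv_g {x : LatticePath n} {l' : List DyckStep} (hx : GStep (List.ofFn x) l') :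
    gInv (g x) = x := by
  have h0 := ofFn_g hx
  obtain ⟨P, Q, h1, rfl, h2, h3, h4⟩ := hx
  rw [h1] at h2 h4
  apply List.ofFn_injective
  rw [h1]
  refine ofFn_flipTouching U 1 _ (g x) P Q h0 ?_ ?_
  · simp only [stepValue]; omega
  · rw [(gStep_spec h2 h3 h4).2.2, stepsFrom_eq_countFrom, h0]

theorem hInv_h {x : LatticePath n} {l' : List DyckStep} (hx : HStep (List.ofFn x) l') :
    hInv (h x) = x := by
  have h0 := ofFn_h hx
  obtain ⟨P, Q, h1, rfl, h2, h3, h4⟩ := hx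
  rw [h1] at h2 h4
  apply List.ofFn_injective
  rw [h1]
  refine ofFn_flipTouching D 0 _ (h x) P Q h0 ?_ ?_
  · simp only [stepValue]; omega
  · rw [(hStep_spec h2 h3 h4).2.2, stepsFrom_eq_countFrom, h0]

/-- The sequence `x, g x, h (g x), g (h (g x)), …`. -/
def orbit (x : LatticePath n) (j : ℕ) : LatticePath n :=
  if j % 2 = 0 then f^[j / 2] x else g (f^[j / 2] x)

theorem orbit_zero (x : LatticePath n) : orbit x 0 = x := rfl

theorem orbit_succ_of_even (x : LatticePath n) {j : ℕ} (hj : j % 2 = 0) :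
    orbit x (j + 1) = g (orbit x j) := by
  rw [orbit, orbit, if_pos hj, if_neg (by omega), show (j + 1) / 2 = j / 2 by omega]

theorem orbit_succ_of_odd (x : LatticePath n) {j : ℕ} (hj : j % 2 = 1) :
    orbit x (j + 1) = h (orbit x j) := by
  rw [orbit, orbit, if_pos (by omega), if_neg (by omega), show (j + 1) / 2 = j / 2 + 1 by omega,
    Function.iterate_succ_apply', f]

/-- A list of steps has rank `2 * e` if it ends at height `0` and has `e` down-steps below the
line `y = 0`; it has rank `2 * e + 1` if it ends at height `2` and has `e` down-steps below the
line `y = 1`. -/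
def HasRank (j : ℕ) (l : List DyckStep) : Prop :=
  listHeight l = 2 * (j % 2 : ℕ) ∧ countDownLE (j % 2 : ℕ) 0 l = j / 2

theorem HasRank.unique {i j : ℕ} {l : List DyckStep} (hi : HasRank i l) (hj : HasRank j l) :
    i = j := by
  have h1 : i % 2 = j % 2 := by
    have := hi.1.symm.trans hj.1
    omega
  have h2 := hi.2
  rw [h1, hj.2] at h2
  omega

theorem hasRank_even {j : ℕ} (hj : j % 2 = 0) {l : List DyckStep} :
    HasRank j l ↔ listHeight l = 0 ∧ countDownLE 0 0 l = j / 2 := by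
  simp [HasRank, hj]

theorem hasRank_odd {j : ℕ} (hj : j % 2 = 1) {l : List DyckStep} :
    HasRank j l ↔ listHeight l = 2 ∧ countDownLE 1 0 l = j / 2 := by
  simp [HasRank, hj]

theorem GStep.even {j : ℕ} {l l' : List DyckStep} (hs : GStep l l') (hl : HasRank j l) :
    j % 2 = 0 := by
  obtain ⟨P, Q, -, -, h2, -⟩ := hs
  have := hl.1
  omega

theorem HStep.odd {j : ℕ} {l l' : List DyckStep} (hs : HStep l l') (hl : HasRank j l) :
    j % 2 = 1 := by
  obtain ⟨P, Q, -, -, h2, -⟩ := hs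
  have := hl.1
  omega

theorem GStep.hasRank {j : ℕ} {l l' : List DyckStep} (hs : GStep l l') (hl : HasRank j l) :
    HasRank (j + 1) l' := by
  have hj := hs.even hl
  obtain ⟨P, Q, rfl, rfl, h2, h3, h4⟩ := hs
  obtain ⟨h5, h6, -⟩ := gStep_spec h2 h3 h4
  rw [hasRank_even hj] at hl
  rw [hasRank_odd (by omega)]
  exact ⟨h5, by omega⟩

theorem HStep.hasRank {j : ℕ} {l l' : List DyckStep} (hs : HStep l l') (hl : HasRank j l) :
    HasRank (j + 1) l' := by
  have hj := hs.odd hl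
  obtain ⟨P, Q, rfl, rfl, h2, h3, h4⟩ := hs
  obtain ⟨h5, h6, -⟩ := hStep_spec h2 h3 h4
  rw [hasRank_odd hj] at hl
  rw [hasRank_even (by omega)]
  exact ⟨h5, by omega⟩

/-- If no down-step started at height `1`, all `k` down-steps would be flaws and the rank would be
`2 * k`. -/
theorem exists_gStep_of_hasRank {j : ℕ} (hj : j % 2 = 0) (hjk : j < 2 * k)
    {x : LatticePath (2 * k)} (hx : HasRank j (List.ofFn x)) :
    ∃ l', GStep (List.ofFn x) l' := by
  rw [hasRank_even hj] at hx
  apply exists_gStep hx.1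
  by_contra h0
  have h1 := countDownLE_eq_count (b := 0) (l := List.ofFn x) (by omega) (by omega)
  have h2 := count_U_add_count_D_ofFn x
  have h3 := listHeight_eq_count (List.ofFn x)
  omega

theorem hasRank_orbit {x : LatticePath (2 * k)} (hx : x ∈ dyckPaths k 0) {j : ℕ}
    (hj : j ≤ 2 * k) : HasRank j (List.ofFn (orbit x j)) := by
  induction j with
  | zero => rw [hasRank_even rfl]; exact mem_dyckPaths_iff.1 hx
  | succ j ih =>
    have ih := ih (by omega)
    rcases Nat.mod_two_eq_zero_or_one j with h0 | h0
    · obtain ⟨l', hl⟩ := exists_gStep_of_hasRank h0 (by omega) ih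
      rw [orbit_succ_of_even x h0, ofFn_g hl]
      exact hl.hasRank ih
    · obtain ⟨l', hl⟩ := exists_hStep ((hasRank_odd h0).1 ih).1
      rw [orbit_succ_of_odd x h0, ofFn_h hl]
      exact hl.hasRank ih

theorem orbit_injOn {x y : LatticePath (2 * k)} (hx : x ∈ dyckPaths k 0)
    (hy : y ∈ dyckPaths k 0) {j : ℕ} (hj : j ≤ 2 * k) (he : orbit x j = orbit y j) : x = y := by
  induction j with
  | zero => exact he
  | succ j ih =>
    apply ih (by omega)
    have h1 := hasRank_orbit hx (show j ≤ 2 * k by omega)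
    have h2 := hasRank_orbit hy (show j ≤ 2 * k by omega)
    rcases Nat.mod_two_eq_zero_or_one j with h0 | h0
    · obtain ⟨_, hl⟩ := exists_gStep_of_hasRank h0 (by omega) h1
      obtain ⟨_, hl'⟩ := exists_gStep_of_hasRank h0 (by omega) h2
      rw [orbit_succ_of_even x h0, orbit_succ_of_even y h0] at he
      rw [← gInv_g hl, he, gInv_g hl']
    · obtain ⟨_, hl⟩ := exists_hStep ((hasRank_odd h0).1 h1).1
      obtain ⟨_, hl'⟩ := exists_hStep ((hasRank_odd h0).1 h2).1
      rw [orbit_succ_of_odd x h0, orbit_succ_of_odd y h0] at he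
      rw [← hInv_h hl, he, hInv_h hl']

/-- The end height decides which flip applies, so a chain of flips can only follow the orbit, and
the rank records its length. -/
theorem eq_orbit_of_reflTransGen {x : LatticePath (2 * k)} (hx : x ∈ dyckPaths k 0)
    {l : List DyckStep} (hl : Relation.ReflTransGen FlipStep (List.ofFn x) l) :
    ∃ j, l = List.ofFn (orbit x j) ∧ HasRank j l := by
  induction hl with
  | refl => exact ⟨0, rfl, hasRank_orbit hx (Nat.zero_le _)⟩
  | tail _ hs ih =>
    obtain ⟨j, rfl, hj⟩ := ih
    rcases hs with hs | hs
    · exact ⟨j + 1, by rw [orbit_succ_of_even x (hs.even hj), ofFn_g hs], hs.hasRank hj⟩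
    · exact ⟨j + 1, by rw [orbit_succ_of_odd x (hs.odd hj), ofFn_h hs], hs.hasRank hj⟩

theorem hasRank_complement {x : LatticePath (2 * k)} (hx : x ∈ dyckPaths k 0) :
    HasRank (2 * k) ((List.ofFn x).map flipStep) := by
  obtain ⟨p, hp⟩ := exists_dyckWord hx
  have hD := isDyck_toList p
  rw [hp] at hD
  rw [hasRank_even (by omega)]
  refine ⟨hD.listHeight_map, ?_⟩
  rw [countDownLE_eq_count (by rw [hD.listHeight_map]; rfl)
    (hD.countFrom_D_map_eq_zero zero_lt_one)]
  have h1 := count_U_add_count_D_ofFn (fun i => flipStep (x i))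
  have h2 := listHeight_eq_count ((List.ofFn x).map flipStep)
  rw [hD.listHeight_map] at h2
  have h3 : List.ofFn (fun i => flipStep (x i)) = (List.ofFn x).map flipStep := by
    rw [List.map_ofFn]; rfl
  rw [h3] at h1
  omega

/-- The sequence ends with the complement of the path it started with. -/
theorem orbit_two_mul {x : LatticePath (2 * k)} (hx : x ∈ dyckPaths k 0) :
    orbit x (2 * k) = fun i => flipStep (x i) := by
  obtain ⟨p, hp⟩ := exists_dyckWord hx
  have hD := isDyck_toList p
  rw [hp] at hD
  have h1 := hD.reflTransGen_flipStep.1 [] [] rfl rfl rfl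
  simp only [List.nil_append, List.append_nil] at h1
  obtain ⟨j, h2, h3⟩ := eq_orbit_of_reflTransGen hx h1
  -- The recursion does not track the number of flips; the rank of the complement forces it to be `2
  -- * k`.
  obtain rfl := h3.unique (hasRank_complement hx)
  apply List.ofFn_injective
  rw [← h2, List.map_ofFn]
  rfl

/-! ### Cycles in the odd graph -/

theorem mem_positions {s : DyckStep} {x : LatticePath n} {i : Fin n} :
    i.castSucc ∈ positions s x ↔ x i = s := by
  simp [positions]

theorem last_notMem_positions (s : DyckStep) (x : LatticePath n) :
    Fin.last n ∉ positions s x := by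
  simp [positions]

theorem card_positions (s : DyckStep) (x : LatticePath n) :
    (positions s x).card = (List.ofFn x).count s := by
  rw [positions, Finset.card_map, card_filter_eq_count]

theorem positions_U_injective : Function.Injective (positions U : LatticePath n → _) := by
  intro x y hxy
  funext i
  have : x i = U ↔ y i = U := by rw [← mem_positions, hxy, mem_positions]
  rcases hx : x i with _ | _ <;> rcases hy : y i with _ | _ <;> simp_all

theorem positions_D_injective : Function.Injective (positions D : LatticePath n → _) := by
  intro x y hxy
  funext i
  have : x i = D ↔ y i = D := by rw [← mem_positions, hxy, mem_positions]
  rcases hx : x i with _ | _ <;> rcases hy : y i with _ | _ <;> simp_all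

theorem cycleSeq_even (x : LatticePath (2 * k)) {j : Fin (2 * k + 1)} (hj : j.val % 2 = 0) :
    cycleSeq k x j = positions U (orbit x j) := by
  rw [cycleSeq, orbit, if_pos hj, if_pos hj]

theorem cycleSeq_odd (x : LatticePath (2 * k)) {j : Fin (2 * k + 1)} (hj : j.val % 2 = 1) :
    cycleSeq k x j = insert (Fin.last (2 * k)) (positions D (orbit x j)) := by
  rw [cycleSeq, orbit, if_neg (by omega), if_neg (by omega)]

theorem last_mem_cycleSeq (x : LatticePath (2 * k)) (j : Fin (2 * k + 1)) :
    Fin.last (2 * k) ∈ cycleSeq k x j ↔ j.val % 2 = 1 := by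
  rcases Nat.mod_two_eq_zero_or_one j with h0 | h0
  · simp [cycleSeq_even x h0, last_notMem_positions, h0]
  · simp [cycleSeq_odd x h0, h0]

theorem card_cycleSeq {x : LatticePath (2 * k)} (hx : x ∈ dyckPaths k 0)
    (j : Fin (2 * k + 1)) : (cycleSeq k x j).card = k := by
  have h1 := hasRank_orbit hx (Nat.lt_succ_iff.1 j.isLt)
  have h2 := listHeight_eq_count (List.ofFn (orbit x j))
  have h3 := count_U_add_count_D_ofFn (orbit x j)
  rcases Nat.mod_two_eq_zero_or_one j with h0 | h0
  · rw [cycleSeq_even x h0, card_positions]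
    rw [hasRank_even h0] at h1
    omega
  · rw [cycleSeq_odd x h0, Finset.card_insert_of_notMem (last_notMem_positions _ _),
      card_positions]
    rw [hasRank_odd h0] at h1
    omega

/-- Membership of the last element reveals the parity of the index, hence the path itself; its rank
gives the index and reversing the flips gives the start. -/
theorem cycleSeq_injective {x y : LatticePath (2 * k)} (hx : x ∈ dyckPaths k 0)
    (hy : y ∈ dyckPaths k 0) {i j : Fin (2 * k + 1)} (he : cycleSeq k x i = cycleSeq k y j) :
    x = y ∧ i = j := by
  have h1 := hasRank_orbit hx (Nat.lt_succ_iff.1 i.isLt)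
  have h2 := hasRank_orbit hy (Nat.lt_succ_iff.1 j.isLt)
  have hp : i.val % 2 = 1 ↔ j.val % 2 = 1 := by
    rw [← last_mem_cycleSeq x, he, last_mem_cycleSeq]
  have h3 : orbit x i = orbit y j := by
    rcases Nat.mod_two_eq_zero_or_one i with h0 | h0
    · rw [cycleSeq_even x h0, cycleSeq_even y (by omega)] at he
      exact positions_U_injective he
    · rw [cycleSeq_odd x h0, cycleSeq_odd y (by omega)] at he
      apply positions_D_injective
      rw [← Finset.erase_insert (last_notMem_positions D (orbit x i)), he,
        Finset.erase_insert (last_notMem_positions D (orbit y j))]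
  rw [h3] at h1
  obtain rfl := Fin.ext (h1.unique h2)
  exact ⟨orbit_injOn hx hy (Nat.lt_succ_iff.1 i.isLt) h3, rfl⟩

theorem eq_D_of_g_eq_D {x : LatticePath n} {i : Fin n} (hi : g x i = D) : x i = D := by
  rw [g, flipTouching] at hi
  split_ifs at hi with hc
  · exact hc.1.1
  · exact hi

theorem eq_U_of_h_eq_U {x : LatticePath n} {i : Fin n} (hi : h x i = U) : x i = U := by
  rw [h, flipTouching] at hi
  split_ifs at hi with hc
  · exact hc.1.1
  · exact hi

theorem disjoint_positions {x y : LatticePath n} (hxy : ∀ i, x i = U → y i ≠ D) :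
    Disjoint (positions U x) (insert (Fin.last n) (positions D y)) := by
  rw [Finset.disjoint_left]
  intro a
  induction a using Fin.lastCases with
  | last => intro ha; exact absurd ha (last_notMem_positions _ _)
  | cast i =>
    intro ha hb
    rw [Finset.mem_insert, mem_positions] at hb
    rw [mem_positions] at ha
    rcases hb with hb | hb
    · exact absurd hb (Fin.castSucc_lt_last i).ne
    · exact hxy i ha hb

theorem disjoint_cycleSeq_succ (x : LatticePath (2 * k)) {i j : Fin (2 * k + 1)}
    (hij : i.val + 1 = j.val) : Disjoint (cycleSeq k x i) (cycleSeq k x j) := by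
  rcases Nat.mod_two_eq_zero_or_one i with h0 | h0
  · rw [cycleSeq_even x h0, cycleSeq_odd x (by omega), ← hij, orbit_succ_of_even x h0]
    refine disjoint_positions fun a ha hb => ?_
    rw [eq_D_of_g_eq_D hb] at ha
    cases ha
  · rw [cycleSeq_odd x h0, cycleSeq_even x (by omega), ← hij, orbit_succ_of_odd x h0]
    refine (disjoint_positions fun a ha hb => ?_).symm
    rw [eq_U_of_h_eq_U ha] at hb
    cases hb

theorem disjoint_cycleSeq_last {x : LatticePath (2 * k)} (hx : x ∈ dyckPaths k 0) :
    Disjoint (cycleSeq k x (Fin.last (2 * k))) (cycleSeq k x 0) := by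
  rw [cycleSeq_even x (by simp), cycleSeq_even x (by simp), Fin.val_last, orbit_two_mul hx,
    Fin.val_zero, orbit_zero]
  rw [Finset.disjoint_left]
  intro a
  induction a using Fin.lastCases with
  | last => intro ha; exact absurd ha (last_notMem_positions _ _)
  | cast i =>
    rw [mem_positions, mem_positions]
    intro h1 h2
    rw [h2] at h1
    cases h1

theorem disjoint_cycleSeq_of_sub_eq_one {x : LatticePath (2 * k)} (hx : x ∈ dyckPaths k 0)
    {i j : Fin (2 * k + 1)} (hij : (j - i).val = 1) :
    Disjoint (cycleSeq k x i) (cycleSeq k x j) := by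
  rcases le_or_gt i j with hle | hlt
  · rw [Fin.sub_val_of_le hle] at hij
    exact disjoint_cycleSeq_succ x (by omega)
  -- The difference wraps around only at the closing edge of the cycle.
  · rw [Fin.coe_sub_iff_lt.2 hlt] at hij
    have hi : i = Fin.last (2 * k) := Fin.ext (by rw [Fin.val_last]; omega)
    have hj : j = 0 := Fin.ext (by rw [Fin.val_zero]; omega)
    rw [hi, hj]
    exact disjoint_cycleSeq_last hx

theorem disjoint_cycleSeq {x : LatticePath (2 * k)} (hx : x ∈ dyckPaths k 0)
    {i j : Fin (2 * k + 1)} (hij : (SimpleGraph.cycleGraph (2 * k + 1)).Adj i j) :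
    Disjoint (cycleSeq k x i) (cycleSeq k x j) := by
  rcases SimpleGraph.cycleGraph_adj'.1 hij with hij | hij
  · exact (disjoint_cycleSeq_of_sub_eq_one hx hij).symm
  · exact disjoint_cycleSeq_of_sub_eq_one hx hij

/-! ### The cycles as subgraphs, and their number -/

/-- The cycle through `x` in the odd graph. -/
def cycleCopy (x : dyckPaths k 0) :
    SimpleGraph.Copy (SimpleGraph.cycleGraph (2 * k + 1)) (oddGraph k) where
  toHom :=
    { toFun := fun j => ⟨cycleSeq k x j, card_cycleSeq x.2 j⟩
      map_rel' := fun hij =>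
        ⟨fun he => hij.ne (cycleSeq_injective x.2 x.2 (congrArg Subtype.val he)).2,
          disjoint_cycleSeq x.2 hij⟩ }
  injective' := fun _ _ he => (cycleSeq_injective x.2 x.2 (congrArg Subtype.val he)).2

theorem mem_verts_cycleCopy {x : dyckPaths k 0} {v : {s : Finset (Fin (2 * k + 1)) // s.card = k}} :
    v ∈ (cycleCopy x).toSubgraph.verts ↔ ∃ j, cycleSeq k x j = v.val := by
  simp only [SimpleGraph.Copy.toSubgraph, SimpleGraph.Subgraph.map_verts,
    SimpleGraph.Subgraph.verts_top, Set.image_univ, Set.mem_range, Subtype.ext_iff]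
  rfl

theorem eq_of_mem_verts {x y : dyckPaths k 0}
    {v : {s : Finset (Fin (2 * k + 1)) // s.card = k}}
    (hx : v ∈ (cycleCopy x).toSubgraph.verts) (hy : v ∈ (cycleCopy y).toSubgraph.verts) :
    x = y := by
  obtain ⟨i, hi⟩ := mem_verts_cycleCopy.1 hx
  obtain ⟨j, hj⟩ := mem_verts_cycleCopy.1 hy
  exact Subtype.ext (cycleSeq_injective x.2 y.2 (hi.trans hj.symm)).1

theorem toSubgraph_cycleCopy_injective :
    Function.Injective fun x : dyckPaths k 0 => (cycleCopy x).toSubgraph := by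
  intro x y hxy
  have hx : cycleCopy x 0 ∈ (cycleCopy x).toSubgraph.verts := mem_verts_cycleCopy.2 ⟨0, rfl⟩
  refine eq_of_mem_verts hx ?_
  rw [← show (cycleCopy x).toSubgraph = (cycleCopy y).toSubgraph from hxy]
  exact hx

theorem ncard_range_cycleCopy (k : ℕ) :
    (Set.range fun x : dyckPaths k 0 => (cycleCopy x).toSubgraph).ncard = catalan k := by
  rw [← Set.image_univ, Set.ncard_image_of_injective _ toSubgraph_cycleCopy_injective,
    Set.ncard_univ, card_dyckPaths_zero]

theorem catalan_mul_two_mul_add_one (k : ℕ) :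
    catalan k * (2 * k + 1) = (2 * k + 1).choose k := by
  have h1 := succ_mul_catalan_eq_centralBinom k
  have h2 := Nat.add_one_mul_choose_eq (2 * k) k
  rw [← Nat.centralBinom_eq_two_mul_choose, ← h1, Nat.choose_symm_half] at h2
  apply Nat.eq_of_mul_eq_mul_right (Nat.succ_pos k)
  rw [Nat.succ_eq_add_one, ← h2]
  ring

end OddCycles

theorem theorem4 (k : ℕ) (hk : 1 ≤ k) :
    ∃ C : OddCycles.dyckPaths k 0 →
        SimpleGraph.Copy (SimpleGraph.cycleGraph (2 * k + 1)) (OddCycles.oddGraph k),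
      (∀ (x : OddCycles.dyckPaths k 0) (j : Fin (2 * k + 1)),
        (C x j).val = OddCycles.cycleSeq k x.val j) ∧
      Function.Injective (fun x => (C x).toSubgraph) ∧
      OddCycles.IsCycleFactor (OddCycles.oddGraph k) (2 * k + 1)
        (Set.range fun x => (C x).toSubgraph) ∧
      (Set.range fun x => (C x).toSubgraph).ncard = catalan k := by
  refine ⟨OddCycles.cycleCopy, fun _ _ => rfl, OddCycles.toSubgraph_cycleCopy_injective,
    ⟨by omega, ?_, ?_, ?_⟩, OddCycles.ncard_range_cycleCopy k⟩
  · rintro _ ⟨x, rfl⟩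
    exact ⟨(OddCycles.cycleCopy x).isoToSubgraph⟩
  · rintro _ ⟨x, rfl⟩ _ ⟨y, rfl⟩ hxy
    refine Set.disjoint_left.2 fun v hx hy => hxy ?_
    rw [OddCycles.eq_of_mem_verts hx hy]
  · rw [OddCycles.ncard_range_cycleCopy, OddCycles.catalan_mul_two_mul_add_one,
      Fintype.card_finset_len, Fintype.card_fin]
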